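/- Let $T$ be a finite tree with adjacency matrix $A$, and let $\lambda\in\mathbb{R}$ be an eigenvalue of $A$. For an eigenvector $x$ of $A$ for $\lambda$ (so $x\neq 0$), let $N(T,x)$ be the set of vertices on which $x$ vanishes, and let $N^C(T,x)$ be the set of those vertices of $N(T,x)$ that are adjacent in $T$ to at least one connected component of $T\setminus N(T,x)$. Let $N_\lambda(T)$ be the set of vertices on which every eigenvector for $\lambda$ vanishes, and let $N^C_\lambda(T)=\bigcup_x N^C(T,x)$, the union being over all eigenvectors $x$ for $\lambda$. Let $C_1,\dots,C_r$ be the connected components of $T\setminus N_\lambda(T)$, and let $T/\{C_i\}_{i=1}^r$ be the graph obtained from $T$ by contracting each $C_i$ to a single vertex $c_i$. The skeleton $S_\lambda(T)$ is the subgraph of $T/\{C_i\}_{i=1}^r$ induced by the vertex set $N^C_\lambda(T)\cup\{c_1,\dots,c_r\}$. A maximum matching is a matching with the largest possible number of edges; it misses a vertex if none of its edges is incident to that vertex. Then: 1. The set of vertices of $S_\lambda(T)$ that are missed by at least one maximum matching of $S_\lambda(T)$ is exactly $\{c_1,\dots,c_r\}$. 2. For every maximum matching of $S_\lambda(T)$,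 the number of vertices of $S_\lambda(T)$ that it misses equals the multiplicity of $\lambda$ as an eigenvalue of $T$ (the dimension of the eigenspace). 3. If $y$ is a vector in the null space of the adjacency matrix of $S_\lambda(T)$ and $y_s\neq 0$ for a vertex $s$ of $S_\lambda(T)$, then $s\in\{c_1,\dots,c_r\}$. -/

import Mathlib

namespace TreeSkeleton

section Eigenvectors

variable {V : Type*} [Fintype V]

open Classical in
/-- The adjacency matrix of a finite graph, as an endomorphism of `V → ℝ`. -/
noncomputable def adjEnd (G : SimpleGraph V) : Module.End ℝ (V → ℝ) :=
  Matrix.toLin' (G.adjMatrix ℝ)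

/-- `lam` is an eigenvalue of the graph `G`. -/
def IsEigenvalue (G : SimpleGraph V) (lam : ℝ) : Prop :=
  (adjEnd G).HasEigenvalue lam

/-- `x` is an eigenvector (in particular nonzero) of `G` for `lam`. -/
def IsEigenvector (G : SimpleGraph V) (lam : ℝ) (x : V → ℝ) : Prop :=
  (adjEnd G).HasEigenvector lam x

/-- The multiplicity of `lam` as an eigenvalue of `G`: the dimension of its eigenspace. -/
noncomputable def multiplicity (G : SimpleGraph V) (lam : ℝ) : ℕ :=
  Module.finrank ℝ ((adjEnd G).eigenspace lam)

/-- The null space of (the adjacency matrix of) `G`. -/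
noncomputable def nullSpace (G : SimpleGraph V) : Submodule ℝ (V → ℝ) :=
  LinearMap.ker (adjEnd G)

end Eigenvectors

section Components

variable {V : Type*}

/-- The components of `G ∖ N`. -/
abbrev Comp (G : SimpleGraph V) (N : Set V) : Type _ :=
  (G.induce Nᶜ).ConnectedComponent

/-- The vertex set, in `G`, of a component of `G ∖ N`. -/
def compVerts (G : SimpleGraph V) (N : Set V) (C : Comp G N) : Set V :=
  Subtype.val '' C.supp

/-- The vertices of the contraction `G / {X i}`: one vertex for each `i`, and the vertices of `G`
that lie in no `X i`. -/
abbrev ContractVertex {ι : Type*} (X : ι → Set V) : Type _ :=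
  ι ⊕ {v : V // ∀ i, v ∉ X i}

/-- The vertices of `G` that a vertex of the contraction stands for. -/
def fibre {ι : Type*} (X : ι → Set V) : ContractVertex X → Set V
  | Sum.inl i => X i
  | Sum.inr v => {v.1}

/-- The contraction `G / {X i}` of mutually disjoint subgraphs with vertex sets `X i`. -/
def contract {ι : Type*} (G : SimpleGraph V) (X : ι → Set V) :
    SimpleGraph (ContractVertex X) where
  Adj a b := a ≠ b ∧ ∃ u ∈ fibre X a, ∃ v ∈ fibre X b, G.Adj u v
  symm := ⟨fun _ _ ⟨hne, u, hu, v, hv, h⟩ => ⟨hne.symm, v, hv, u, hu, h.symm⟩⟩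
  loopless := ⟨fun _ h => h.1 rfl⟩

end Components

section Skeleton

variable {V : Type*}

/-- `N(G, x)`: the vertices on which `x` vanishes. -/
def zeroSet (x : V → ℝ) : Set V := {v | x v = 0}

/-- `N^C(G, x)`: the vertices of `N(G, x)` adjacent to some component of `G ∖ N(G, x)`. -/
def adjZeroSet (G : SimpleGraph V) (x : V → ℝ) : Set V :=
  {v | v ∈ zeroSet x ∧ ∃ C : Comp G (zeroSet x), ∃ w ∈ compVerts G (zeroSet x) C, G.Adj v w}

variable [Fintype V]

/-- `N_lam(G)`: the vertices on which every eigenvector for `lam` vanishes. -/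
def eigZeroSet (G : SimpleGraph V) (lam : ℝ) : Set V :=
  {v | ∀ x, IsEigenvector G lam x → v ∈ zeroSet x}

/-- `N^C_lam(G)`: the union of the sets `N^C(G, x)` over the eigenvectors `x` for `lam`. -/
def eigAdjZeroSet (G : SimpleGraph V) (lam : ℝ) : Set V :=
  {v | ∃ x, IsEigenvector G lam x ∧ v ∈ adjZeroSet G x}

/-- The set of vertices of the skeleton, within the vertices of the contraction of all components
of `G ∖ N_lam(G)`: the contracted components and the vertices of `N^C_lam(G)`. -/
def skeletonVertexSet (G : SimpleGraph V) (lam : ℝ) :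
    Set (ContractVertex (compVerts G (eigZeroSet G lam))) :=
  Set.range Sum.inl ∪ {p | ∃ v, p = Sum.inr v ∧ v.1 ∈ eigAdjZeroSet G lam}

/-- The vertex type of the skeleton. -/
def SkeletonVertex (G : SimpleGraph V) (lam : ℝ) : Type _ :=
  ↥(skeletonVertexSet G lam)

instance (G : SimpleGraph V) (lam : ℝ) : Finite (SkeletonVertex G lam) := by
  unfold SkeletonVertex
  infer_instance

noncomputable instance (G : SimpleGraph V) (lam : ℝ) : Fintype (SkeletonVertex G lam) :=
  Fintype.ofFinite _

/-- The skeleton `S_lam(G)`: the subgraph that the skeleton vertices induce in the contraction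
of all components of `G ∖ N_lam(G)`. -/
def skeleton (G : SimpleGraph V) (lam : ℝ) : SimpleGraph (SkeletonVertex G lam) :=
  (contract G (compVerts G (eigZeroSet G lam))).induce (skeletonVertexSet G lam)

/-- The skeleton vertices that are contracted components of `G ∖ N_lam(G)`. -/
def contractedVertices (G : SimpleGraph V) (lam : ℝ) : Set (SkeletonVertex G lam) :=
  {s | ∃ C : Comp G (eigZeroSet G lam), s.1 = Sum.inl C}

end Skeleton

/-- A matching with the largest number of edges (for finite graphs). The vertices it misses are
those not in `M.verts`. -/
def IsMaximumMatching {W : Type*} {H : SimpleGraph W} (M : H.Subgraph) : Prop :=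
  M.IsMatching ∧ ∀ M' : H.Subgraph, M'.IsMatching → M'.edgeSet.ncard ≤ M.edgeSet.ncard

end TreeSkeleton

/-!
A forest carries a depth function, the distance to a chosen root of each connected component. Two
eigenvectors `x`, `y` for `lam` satisfy `x v * y w = x w * y v` along each edge, because the
difference of the two sides is an antisymmetric function of the oriented edges without divergence,
and peeling off the deepest vertices shows that a forest carries no other one than `0`. An
eigenvector `x` with the fewest zeros therefore spans, by rescaling on each component of the
complement of `N_lam`, a space that contains the eigenspace; the eigenspace is cut out of it by one
equation for each boundary vertex, a vertex of `N_lam` with a neighbour outside `N_lam`.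

The values of `x` at the neighbours of a boundary vertex `a` sum to zero, so `a` has a child outside
`N_lam`; assign to `a` the component of this child. Every other boundary vertex adjacent to that
component is deeper than `a`. By this triangularity the equations are independent, so the
multiplicity is the number of components minus the number of boundary vertices; the null vectors of
the skeleton vanish on the boundary vertices; and the boundary vertices are matched into the
components, avoiding the component of a given root. As the components are independent in the
skeleton, no matching has more edges than there are boundary vertices, and a matching with that many
edges covers each of them.
-/

namespace TreeSkeleton

section LinearAlgebra

lemma linearIndependent_of_triangular {R A C ι : Type*} [Ring R] [NoZeroDivisors R]
    [LinearOrder ι] {B : A → C → R} (κ : A → C) (d : A → ι) (hdiag : ∀ a, B a (κ a) ≠ 0)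
    (htri : ∀ a a', B a' (κ a) ≠ 0 → a' = a ∨ d a < d a') : LinearIndependent R B := by
  classical
  refine linearIndependent_iff'.mpr fun s g hg a₀ ha₀ => ?_
  by_contra hne
  obtain ⟨a, ha, hmax⟩ := (s.filter (g · ≠ 0)).exists_max_image d
    ⟨a₀, Finset.mem_filter.mpr ⟨ha₀, hne⟩⟩
  obtain ⟨has, hga⟩ := Finset.mem_filter.mp ha
  have hsum : ∑ a' ∈ s, g a' * B a' (κ a) = g a * B a (κ a) := by
    refine Finset.sum_eq_single_of_mem a has fun a' ha' haa' => ?_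
    by_contra hmul
    obtain ⟨hga', hB⟩ := mul_ne_zero_iff.mp hmul
    exact (hmax a' (Finset.mem_filter.mpr ⟨ha', hga'⟩)).not_gt
      ((htri a a' hB).resolve_left haa')
  refine mul_ne_zero hga (hdiag a) (hsum.symm.trans ?_)
  simpa using congrFun hg (κ a)

end LinearAlgebra

section Depth

variable {V : Type*} {G : SimpleGraph V} {d : V → ℕ}

/-- `v` is a child of `p` in the graph `G` with depth function `d`. -/
def IsChild (G : SimpleGraph V) (d : V → ℕ) (p v : V) : Prop :=
  G.Adj p v ∧ d v = d p + 1

/-- A depth function of a rooted forest: the ends of an edge are parent and child, and a vertex has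
at most one parent. This is all that the arguments by descent need to know about a forest. -/
structure IsDepthFunction (G : SimpleGraph V) (d : V → ℕ) : Prop where
  isChild_or_isChild : ∀ ⦃v w⦄, G.Adj v w → IsChild G d v w ∨ IsChild G d w v
  parent_unique : ∀ ⦃p q v⦄, IsChild G d p v → IsChild G d q v → p = q

lemma isDepthFunction_dist_root (hG : G.IsAcyclic) {root : G.ConnectedComponent → V}
    (hroot : ∀ v, G.Reachable (root (G.connectedComponentMk v)) v) :
    IsDepthFunction G fun v => G.dist (root (G.connectedComponentMk v)) v where
  isChild_or_isChild v w hvw := by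
    have hroots : root (G.connectedComponentMk w) = root (G.connectedComponentMk v) := by
      rw [SimpleGraph.ConnectedComponent.connectedComponentMk_eq_of_adj hvw]
    simp only [IsChild, hvw, hvw.symm, true_and, hroots]
    exact (hG.dist_eq_dist_add_one_of_adj_of_reachable _ hvw (hroot v)).symm
  parent_unique p q v hp hq := by
    have exists_path : ∀ u, IsChild G (fun v => G.dist (root (G.connectedComponentMk v)) v) u v →
        ∃ P : G.Path (root (G.connectedComponentMk v)) v, P.1.penultimate = u := by
      rintro u ⟨huv, hdu⟩
      dsimp only at hdu
      rw [SimpleGraph.ConnectedComponent.connectedComponentMk_eq_of_adj huv] at hdu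
      obtain ⟨P, hP⟩ := ((hroot v).trans huv.symm.reachable).exists_walk_length_eq_dist
      refine ⟨⟨P.concat huv, SimpleGraph.Walk.isPath_of_length_eq_dist _ ?_⟩,
        SimpleGraph.Walk.penultimate_concat ..⟩
      rw [SimpleGraph.Walk.length_concat, hP, hdu]
    obtain ⟨P, rfl⟩ := exists_path p hp
    obtain ⟨Q, rfl⟩ := exists_path q hq
    rw [(hG.subsingleton_path _ _).elim P Q]

lemma exists_isDepthFunction_apply_eq_zero (hG : G.IsAcyclic) (r : V) :
    ∃ d, IsDepthFunction G d ∧ d r = 0 := by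
  classical
  let root : G.ConnectedComponent → V := fun C => if C = G.connectedComponentMk r then r else C.out
  have hroot : ∀ v, G.Reachable (root (G.connectedComponentMk v)) v := by
    refine fun v => SimpleGraph.ConnectedComponent.exact ?_
    simp only [root]
    split_ifs with hv
    · exact hv.symm
    · exact Quot.out_eq _
  refine ⟨_, isDepthFunction_dist_root hG hroot, ?_⟩
  simp only [root, if_pos, SimpleGraph.dist_self]

lemma exists_isDepthFunction (hG : G.IsAcyclic) : ∃ d, IsDepthFunction G d := by
  rcases isEmpty_or_nonempty V with hV | ⟨⟨r⟩⟩
  · exact ⟨0, fun v => hV.elim v, fun p => hV.elim p⟩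
  · exact (exists_isDepthFunction_apply_eq_zero hG r).imp fun _ => And.left

lemma eq_zero_of_antisymm_of_sum_neighborFinset_eq_zero [Fintype V] [DecidableRel G.Adj]
    {M : Type*} [AddCommGroup M] (hG : G.IsAcyclic) {f : V → V → M}
    (hanti : ∀ v w, f v w = -f w v) (hdiv : ∀ v, ∑ w ∈ G.neighborFinset v, f v w = 0) {v w : V}
    (hvw : G.Adj v w) : f v w = 0 := by
  classical
  obtain ⟨d, hd⟩ := exists_isDepthFunction hG
  have eq_zero_of_isChild : ∀ v p, IsChild G d p v → f v p = 0 := by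
    by_contra! hne
    obtain ⟨v₀, hv₀⟩ := hne
    obtain ⟨v, hv, hmax⟩ :=
      (Finset.univ.filter fun v => ∃ p, IsChild G d p v ∧ f v p ≠ 0).exists_max_image d
        ⟨v₀, by simpa using hv₀⟩
    obtain ⟨p, hpv, hfp⟩ := (Finset.mem_filter.mp hv).2
    refine hfp ((Finset.sum_eq_single_of_mem p (by simpa using hpv.1.symm) ?_).symm.trans (hdiv v))
    intro c hc hcp
    rcases hd.isChild_or_isChild ((G.mem_neighborFinset v c).mp hc) with hvc | hcv
    · by_contra hfc
      have hle := hmax c (by simpa using ⟨v, hvc, fun h => hfc (by rw [hanti, h, neg_zero])⟩)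
      have := hvc.2
      omega
    · exact absurd (hd.parent_unique hcv hpv) hcp
  rcases hd.isChild_or_isChild hvw with h | h
  · rw [hanti, eq_zero_of_isChild w v h, neg_zero]
  · exact eq_zero_of_isChild v w h

end Depth

section Boundary

variable {V : Type*} {G : SimpleGraph V} {N : Set V} {d : V → ℕ}

lemma mem_compVerts {C : Comp G N} {v : V} :
    v ∈ compVerts G N C ↔ ∃ h : v ∉ N, (G.induce Nᶜ).connectedComponentMk ⟨v, h⟩ = C := by
  simp [compVerts, SimpleGraph.ConnectedComponent.mem_supp_iff]

lemma forall_notMem_compVerts_iff {v : V} : (∀ C, v ∉ compVerts G N C) ↔ v ∈ N := by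
  simp [mem_compVerts]

lemma mem_compVerts_iff_of_adj {C : Comp G N} {v w : V} (hvw : G.Adj v w) (hv : v ∉ N)
    (hw : w ∉ N) : v ∈ compVerts G N C ↔ w ∈ compVerts G N C := by
  have hadj : (G.induce Nᶜ).Adj ⟨v, hv⟩ ⟨w, hw⟩ := hvw
  simp only [mem_compVerts, hv, hw, not_false_eq_true, exists_true_left,
    SimpleGraph.ConnectedComponent.connectedComponentMk_eq_of_adj hadj]

/-- The vertices of `N` with a neighbour outside `N`. For `N = N_lam(G)` they are the vertices of
the skeleton that are not contracted components. -/
def boundary (G : SimpleGraph V) (N : Set V) : Set V :=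
  {v | v ∈ N ∧ ∃ w ∉ N, G.Adj v w}

namespace IsDepthFunction

/-- A path that leaves `w` inside `Nᶜ` starts downwards, as the parent of `w` lies in `N`; from then
on it cannot turn upwards without retracing its steps. -/
lemma reflTransGen_isChild_of_reachable (hd : IsDepthFunction G d) {a : V} (ha : a ∈ N)
    {w v : (Nᶜ : Set V)} (haw : IsChild G d a w) (hwv : (G.induce Nᶜ).Reachable w v) :
    Relation.ReflTransGen (IsChild G d) w v := by
  rw [SimpleGraph.reachable_iff_reflTransGen] at hwv
  induction hwv with
  | refl => exact .refl
  | @tail b c _ hbc ih =>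
    rcases hd.isChild_or_isChild (show G.Adj b c from hbc) with hbc' | hcb
    · exact ih.tail hbc'
    · rcases ih.cases_tail with hbw | ⟨p, hwp, hpb⟩
      · exact absurd ha (hd.parent_unique haw (hbw ▸ hcb) ▸ c.2)
      · rwa [hd.parent_unique hcb hpb]

lemma eq_or_lt_of_reachable (hd : IsDepthFunction G d) {a : V} (ha : a ∈ N) {w v : (Nᶜ : Set V)}
    (haw : IsChild G d a w) (hwv : (G.induce Nᶜ).Reachable w v) : v = w ∨ d w < d v := by
  have hle : ∀ {p q}, Relation.ReflTransGen (IsChild G d) p q → d p ≤ d q := by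
    intro p q hpq
    induction hpq with
    | refl => exact le_rfl
    | tail _ hbc ih => exact ih.trans (hbc.2 ▸ Nat.le_succ _)
  rcases (hd.reflTransGen_isChild_of_reachable ha haw hwv).cases_tail with hvw | ⟨p, hwp, hpv⟩
  · exact .inl (Subtype.ext hvw)
  · exact .inr (hpv.2 ▸ Nat.lt_succ_of_le (hle hwp))

lemma eq_or_lt_of_adj_compVerts (hd : IsDepthFunction G d) {a a' v : V} {w : (Nᶜ : Set V)}
    (ha : a ∈ N) (haw : IsChild G d a w)
    (hv : v ∈ compVerts G N ((G.induce Nᶜ).connectedComponentMk w)) (hav : G.Adj a' v) :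
    a' = a ∧ v = w ∨ d a < d a' := by
  obtain ⟨hvN, hvw⟩ := mem_compVerts.mp hv
  have hdw := haw.2
  rcases hd.eq_or_lt_of_reachable ha haw (SimpleGraph.ConnectedComponent.exact hvw.symm)
    with rfl | hlt
  · rcases hd.isChild_or_isChild hav with hchild | ⟨-, hda'⟩
    · exact .inl ⟨hd.parent_unique hchild haw, rfl⟩
    · exact .inr (by simp only at hdw; omega)
  · rcases hd.isChild_or_isChild hav with ⟨-, hdv⟩ | ⟨-, hda'⟩ <;>
      exact .inr (by simp only at hlt; omega)

lemma connectedComponentMk_child_ne (hd : IsDepthFunction G d) {a : V} (ha : a ∈ N)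
    {w r : (Nᶜ : Set V)} (haw : IsChild G d a w) (hr : d r = 0) :
    (G.induce Nᶜ).connectedComponentMk w ≠ (G.induce Nᶜ).connectedComponentMk r := by
  intro h
  have hdw := haw.2
  rcases hd.eq_or_lt_of_reachable ha haw (SimpleGraph.ConnectedComponent.exact h) with rfl | hlt <;>
    omega

variable {child : boundary G N → (Nᶜ : Set V)}

lemma injective_connectedComponentMk_child (hd : IsDepthFunction G d)
    (hchild : ∀ a : boundary G N, IsChild G d a (child a)) :
    Function.Injective fun a => (G.induce Nᶜ).connectedComponentMk (child a) := by
  intro a a' h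
  have hlt : ∀ {b b' : boundary G N}, (G.induce Nᶜ).connectedComponentMk (child b) =
      (G.induce Nᶜ).connectedComponentMk (child b') → (b' : V) = b ∨ d b < d b' := fun {b b'} h =>
    (hd.eq_or_lt_of_adj_compVerts b.2.1 (hchild b) (mem_compVerts.mpr ⟨(child b').2, h.symm⟩)
      (hchild b').1).imp_left And.left
  rcases hlt h with h₁ | h₁
  · exact Subtype.ext h₁.symm
  · rcases hlt h.symm with h₂ | h₂
    · exact Subtype.ext h₂
    · omega

lemma linearIndependent_of_incidence {R : Type*} [Ring R] [NoZeroDivisors R]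
    (hd : IsDepthFunction G d) (hchild : ∀ a : boundary G N, IsChild G d a (child a))
    {B : boundary G N → Comp G N → R}
    (hdiag : ∀ a, B a ((G.induce Nᶜ).connectedComponentMk (child a)) ≠ 0)
    (hsupp : ∀ a C, B a C ≠ 0 → ∃ v ∈ compVerts G N C, G.Adj a v) : LinearIndependent R B := by
  refine linearIndependent_of_triangular _ (fun a => d a) hdiag fun a a' hB => ?_
  obtain ⟨v, hv, hav⟩ := hsupp _ _ hB
  exact (hd.eq_or_lt_of_adj_compVerts a.2.1 (hchild a) hv hav).imp_left
    fun h => Subtype.ext h.1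

end IsDepthFunction

end Boundary

section Matching

variable {W : Type*} [Finite W] {H : SimpleGraph W} {K : Set W} {M : H.Subgraph}

lemma ncard_verts_of_isMatching (hM : M.IsMatching) : M.verts.ncard = 2 * M.edgeSet.ncard := by
  classical
  have := Fintype.ofFinite W
  have hdeg : ∀ v, M.spanningCoe.degree v = if v ∈ M.verts then 1 else 0 := by
    intro v
    rw [SimpleGraph.Subgraph.degree_spanningCoe]
    split_ifs with hv
    · exact SimpleGraph.Subgraph.isMatching_iff_forall_degree.mp hM v hv
    · exact M.degree_of_notMem_verts hv
  have hedges : M.edgeSet.ncard = M.spanningCoe.edgeFinset.card := by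
    rw [← M.edgeSet_spanningCoe, ← SimpleGraph.coe_edgeFinset M.spanningCoe, Set.ncard_coe_finset]
  rw [hedges, ← M.spanningCoe.sum_degrees_eq_twice_card_edges,
    Finset.sum_congr rfl fun v _ => hdeg v, Finset.sum_boole, Nat.cast_id, ← Set.ncard_coe_finset,
    Finset.coe_filter_univ]
  rfl

lemma exists_isMatching_of_injective {ι : Type*} {f g : ι → W} (hf : f.Injective)
    (hg : g.Injective) (hfg : Disjoint (Set.range f) (Set.range g))
    (hadj : ∀ i, H.Adj (f i) (g i)) :
    ∃ M : H.Subgraph, M.IsMatching ∧ M.verts = Set.range f ∪ Set.range g ∧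
      M.edgeSet.ncard = Nat.card ι := by
  obtain ⟨M, hverts, hM⟩ := SimpleGraph.Subgraph.IsMatching.exists_of_disjoint_sets_of_equiv
    (G := H) hfg ((Equiv.ofInjective f hf).symm.trans (Equiv.ofInjective g hg))
    (by rintro ⟨_, i, rfl⟩; simpa using hadj i)
  have hcard := ncard_verts_of_isMatching hM
  rw [hverts, Set.ncard_union_eq hfg, Set.ncard_range_of_injective hf,
    Set.ncard_range_of_injective hg] at hcard
  exact ⟨M, hM, hverts, by omega⟩

lemma ncard_verts_inter_le_ncard_verts_diff (hK : H.IsIndepSet K) (hM : M.IsMatching) :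
    (M.verts ∩ K).ncard ≤ (M.verts \ K).ncard := by
  choose! partner hpartner using fun v (hv : v ∈ M.verts) => (hM hv).exists
  refine Set.ncard_le_ncard_of_injOn partner ?_ ?_
  · rintro v ⟨hv, hvK⟩
    have hadj := (hpartner v hv).adj_sub
    exact ⟨(hpartner v hv).snd_mem, fun hK' => hK hvK hK' hadj.ne hadj⟩
  · rintro v ⟨hv, -⟩ w ⟨hw, -⟩ hvw
    exact hM.eq_of_adj_right (hpartner v hv) (hvw ▸ hpartner w hw)

lemma ncard_edgeSet_le_ncard_verts_diff (hK : H.IsIndepSet K) (hM : M.IsMatching) :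
    M.edgeSet.ncard ≤ (M.verts \ K).ncard := by
  have hle := ncard_verts_inter_le_ncard_verts_diff hK hM
  have hsplit := Set.ncard_inter_add_ncard_sdiff_eq_ncard M.verts K
  have hverts := ncard_verts_of_isMatching hM
  omega

lemma ncard_edgeSet_le_ncard_compl (hK : H.IsIndepSet K) (hM : M.IsMatching) :
    M.edgeSet.ncard ≤ Kᶜ.ncard :=
  (ncard_edgeSet_le_ncard_verts_diff hK hM).trans (Set.ncard_le_ncard fun _ hv => hv.2)

lemma compl_subset_verts_of_ncard_edgeSet_eq (hK : H.IsIndepSet K) (hM : M.IsMatching)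
    (hcard : M.edgeSet.ncard = Kᶜ.ncard) : Kᶜ ⊆ M.verts := by
  have hdiff : M.verts \ K = Kᶜ := Set.eq_of_subset_of_ncard_le (fun _ hv => hv.2)
    (hcard ▸ ncard_edgeSet_le_ncard_verts_diff hK hM)
  exact hdiff ▸ Set.sdiff_subset

lemma isMaximumMatching_iff_ncard_edgeSet_eq (hK : H.IsIndepSet K)
    (hsat : ∃ M₀ : H.Subgraph, M₀.IsMatching ∧ M₀.edgeSet.ncard = Kᶜ.ncard) :
    IsMaximumMatching M ↔ M.IsMatching ∧ M.edgeSet.ncard = Kᶜ.ncard := by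
  obtain ⟨M₀, hM₀, hcard₀⟩ := hsat
  refine and_congr_right fun hM => ⟨fun hmax => ?_, fun hcard M' hM' => ?_⟩
  · exact (ncard_edgeSet_le_ncard_compl hK hM).antisymm (hcard₀ ▸ hmax M₀ hM₀)
  · exact hcard ▸ ncard_edgeSet_le_ncard_compl hK hM'

lemma setOf_missed_by_isMaximumMatching_eq (hK : H.IsIndepSet K)
    (hsat : ∃ M₀ : H.Subgraph, M₀.IsMatching ∧ M₀.edgeSet.ncard = Kᶜ.ncard)
    (havoid : ∀ c ∈ K, ∃ M : H.Subgraph,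
      M.IsMatching ∧ M.edgeSet.ncard = Kᶜ.ncard ∧ c ∉ M.verts) :
    {s | ∃ M : H.Subgraph, IsMaximumMatching M ∧ s ∉ M.verts} = K := by
  simp only [isMaximumMatching_iff_ncard_edgeSet_eq hK hsat, and_assoc]
  refine Set.Subset.antisymm ?_ havoid
  rintro s ⟨M, hM, hcard, hs⟩
  by_contra hsK
  exact hs (compl_subset_verts_of_ncard_edgeSet_eq hK hM hcard hsK)

lemma ncard_missed_add_ncard_compl (hM : M.IsMatching) (hcard : M.edgeSet.ncard = Kᶜ.ncard) :
    {s | s ∉ M.verts}.ncard + Kᶜ.ncard = K.ncard := by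
  have hverts := ncard_verts_of_isMatching hM
  have hsplit := Set.ncard_add_ncard_compl M.verts
  have hsplitK := Set.ncard_add_ncard_compl K
  change M.vertsᶜ.ncard + _ = _
  omega

end Matching

section CompPart

variable {V : Type*} {G : SimpleGraph V} {x : V → ℝ}

/-- The restriction of `x` to a component of the complement of its zeros, extended by zero. -/
noncomputable def compPart (G : SimpleGraph V) (x : V → ℝ) (C : Comp G (zeroSet x)) : V → ℝ :=
  (compVerts G (zeroSet x) C).indicator x

lemma compPart_apply_eq_zero {C : Comp G (zeroSet x)} {v : V} (hv : v ∈ zeroSet x) :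
    compPart G x C v = 0 :=
  Set.indicator_of_notMem (fun hvC => (mem_compVerts.mp hvC).1 hv) x

lemma mem_compVerts_of_compPart_ne_zero {C : Comp G (zeroSet x)} {v : V}
    (hv : compPart G x C v ≠ 0) : v ∈ compVerts G (zeroSet x) C :=
  Set.mem_of_indicator_ne_zero hv

lemma linearIndependent_compPart : LinearIndependent ℝ (compPart G x) := by
  have hrep : ∀ C : Comp G (zeroSet x), ∃ v, v ∈ compVerts G (zeroSet x) C :=
    fun C => C.nonempty_supp.image _
  choose v hv using hrep
  refine linearIndependent_of_triangular v (fun _ => 0) (fun C => ?_) fun C C' hne => .inl ?_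
  · rw [compPart, Set.indicator_of_mem (hv C)]
    exact (mem_compVerts.mp (hv C)).1
  · obtain ⟨_, hC⟩ := mem_compVerts.mp (hv C)
    obtain ⟨_, hC'⟩ := mem_compVerts.mp (mem_compVerts_of_compPart_ne_zero hne)
    exact hC'.symm.trans hC

variable [Fintype (Comp G (zeroSet x))]

lemma sum_smul_compPart_apply_of_mem (α : Comp G (zeroSet x) → ℝ) {v : V} (hv : v ∈ zeroSet x) :
    (∑ C, α C • compPart G x C) v = 0 := by
  simp [compPart_apply_eq_zero hv]

lemma sum_smul_compPart_apply_of_notMem (α : Comp G (zeroSet x) → ℝ) {v : V}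
    (hv : v ∉ zeroSet x) : (∑ C, α C • compPart G x C) v =
      α ((G.induce (zeroSet x)ᶜ).connectedComponentMk ⟨v, hv⟩) * x v := by
  rw [Finset.sum_apply, Finset.sum_eq_single_of_mem _ (Finset.mem_univ _), Pi.smul_apply,
    compPart, Set.indicator_of_mem (mem_compVerts.mpr ⟨hv, rfl⟩), smul_eq_mul]
  intro C _ hne
  rw [Pi.smul_apply, compPart, Set.indicator_of_notMem, smul_zero]
  exact fun hvC => hne (mem_compVerts.mp hvC).2.symm

end CompPart

section Eigenspace

variable {V : Type*} [Fintype V] {G : SimpleGraph V} {lam : ℝ} {x y : V → ℝ}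

open Classical in
lemma adjEnd_apply (G : SimpleGraph V) (x : V → ℝ) (v : V) :
    adjEnd G x v = ∑ w ∈ G.neighborFinset v, x w := by
  rw [adjEnd, Matrix.toLin'_apply, SimpleGraph.adjMatrix_mulVec_apply]

lemma mem_eigenspace_iff : x ∈ (adjEnd G).eigenspace lam ↔ ∀ v, adjEnd G x v = lam * x v := by
  rw [Module.End.mem_eigenspace_iff, funext_iff]
  rfl

lemma mem_eigZeroSet {v : V} :
    v ∈ eigZeroSet G lam ↔ ∀ x ∈ (adjEnd G).eigenspace lam, x v = 0 := by
  refine ⟨fun hv x hx => ?_, fun hv x hx => hv x hx.1⟩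
  by_cases hx0 : x = 0
  · rw [hx0, Pi.zero_apply]
  · exact hv x ⟨hx, hx0⟩

lemma exists_zeroSet_eq_eigZeroSet (G : SimpleGraph V) (lam : ℝ) :
    ∃ x ∈ (adjEnd G).eigenspace lam, zeroSet x = eigZeroSet G lam := by
  obtain ⟨x, hx, hne⟩ := Module.Dual.exists_forall_mem_ne_zero_of_forall_exists
    ((adjEnd G).eigenspace lam) (fun v : {v // v ∉ eigZeroSet G lam} => LinearMap.proj v.1)
    fun v => by simpa [mem_eigZeroSet] using v.2
  exact ⟨x, hx, Set.Subset.antisymm (fun v hv => by_contra fun hvN => hne ⟨v, hvN⟩ hv)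
    fun v hv => mem_eigZeroSet.mp hv x hx⟩

lemma eigenvector_mul_eq_of_adj (hG : G.IsAcyclic) (hx : x ∈ (adjEnd G).eigenspace lam)
    (hy : y ∈ (adjEnd G).eigenspace lam) {v w : V} (hvw : G.Adj v w) :
    x v * y w = x w * y v := by
  classical
  refine sub_eq_zero.mp (eq_zero_of_antisymm_of_sum_neighborFinset_eq_zero hG
    (f := fun v w => x v * y w - x w * y v) (fun v w => by ring) (fun v => ?_) hvw)
  calc ∑ w ∈ G.neighborFinset v, (x v * y w - x w * y v)
      = x v * ∑ w ∈ G.neighborFinset v, y w - (∑ w ∈ G.neighborFinset v, x w) * y v := by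
        rw [Finset.sum_sub_distrib, Finset.mul_sum, Finset.sum_mul]
    _ = x v * (lam * y v) - lam * x v * y v := by
        rw [← adjEnd_apply, ← adjEnd_apply, mem_eigenspace_iff.mp hx, mem_eigenspace_iff.mp hy]
    _ = 0 := by ring

lemma IsDepthFunction.exists_child_notMem_zeroSet {d : V → ℕ} (hd : IsDepthFunction G d)
    (hx : x ∈ (adjEnd G).eigenspace lam) {a : V} (ha : a ∈ boundary G (zeroSet x)) :
    ∃ w : ((zeroSet x)ᶜ : Set V), IsChild G d a w := by
  classical
  obtain ⟨hxa, w, hw, haw⟩ := ha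
  by_contra! hnone
  have hwa : IsChild G d w a := (hd.isChild_or_isChild haw).resolve_left (hnone ⟨w, hw⟩)
  refine hw ?_
  calc x w = ∑ u ∈ G.neighborFinset a, x u := by
        refine (Finset.sum_eq_single_of_mem w (by simpa using haw) fun u hu huw => ?_).symm
        by_contra hxu
        rcases hd.isChild_or_isChild ((G.mem_neighborFinset a u).mp hu) with hau | hua
        · exact hnone ⟨u, hxu⟩ hau
        · exact huw (hd.parent_unique hua hwa)
    _ = adjEnd G x a := (adjEnd_apply G x a).symm
    _ = 0 := by rw [mem_eigenspace_iff.mp hx, show x a = 0 from hxa, mul_zero]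

lemma IsDepthFunction.exists_child_notMem_eigZeroSet {d : V → ℕ} (hd : IsDepthFunction G d)
    {a : V} (ha : a ∈ boundary G (eigZeroSet G lam)) :
    ∃ w : ((eigZeroSet G lam)ᶜ : Set V), IsChild G d a w := by
  obtain ⟨x, hx, hx0⟩ := exists_zeroSet_eq_eigZeroSet G lam
  rw [← hx0] at ha ⊢
  exact hd.exists_child_notMem_zeroSet hx ha

lemma adjEnd_compPart_of_notMem_boundary (hx : x ∈ (adjEnd G).eigenspace lam)
    (C : Comp G (zeroSet x)) {v : V} (hv : v ∉ boundary G (zeroSet x)) :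
    adjEnd G (compPart G x C) v = lam * compPart G x C v := by
  classical
  rw [adjEnd_apply]
  by_cases hxv : v ∈ zeroSet x
  · rw [compPart_apply_eq_zero hxv, mul_zero]
    refine Finset.sum_eq_zero fun w hw => compPart_apply_eq_zero ?_
    by_contra hxw
    exact hv ⟨hxv, w, hxw, (G.mem_neighborFinset v w).mp hw⟩
  have hiff : ∀ w ∈ G.neighborFinset v, x w ≠ 0 →
      (w ∈ compVerts G (zeroSet x) C ↔ v ∈ compVerts G (zeroSet x) C) := fun w hw hxw =>
    (mem_compVerts_iff_of_adj ((G.mem_neighborFinset v w).mp hw) hxv hxw).symm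
  by_cases hvC : v ∈ compVerts G (zeroSet x) C
  · rw [compPart, Set.indicator_of_mem hvC, ← mem_eigenspace_iff.mp hx, adjEnd_apply]
    refine Finset.sum_congr rfl fun w hw => ?_
    by_cases hxw : x w = 0
    · rw [hxw]
      exact compPart_apply_eq_zero hxw
    · exact Set.indicator_of_mem ((hiff w hw hxw).mpr hvC) x
  · rw [compPart, Set.indicator_of_notMem hvC, mul_zero]
    refine Finset.sum_eq_zero fun w hw => ?_
    by_contra hne
    have hwC := mem_compVerts_of_compPart_ne_zero hne
    exact hvC ((hiff w hw (mem_compVerts.mp hwC).1).mp hwC)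

/-- The matrix of the equations, one for each vertex of the boundary of `zeroSet x`, which single
out the vectors of the eigenspace of `x` among the linear combinations of the `compPart G x C`. -/
noncomputable def boundaryMatrix (G : SimpleGraph V) (x : V → ℝ) :
    Matrix (boundary G (zeroSet x)) (Comp G (zeroSet x)) ℝ :=
  fun a C => adjEnd G (compPart G x C) a

lemma linearIndependent_boundaryMatrix (hG : G.IsAcyclic) (hx : x ∈ (adjEnd G).eigenspace lam) :
    LinearIndependent ℝ (boundaryMatrix G x).row := by
  classical
  obtain ⟨d, hd⟩ := exists_isDepthFunction hG
  choose child hchild using fun a : boundary G (zeroSet x) => hd.exists_child_notMem_zeroSet hx a.2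
  have hentry : ∀ a C, boundaryMatrix G x a C = ∑ v ∈ G.neighborFinset a, compPart G x C v :=
    fun a C => adjEnd_apply G _ a
  refine hd.linearIndependent_of_incidence hchild (fun a => ?_) fun a C hne => ?_
  · have hmem : (child a : V) ∈ G.neighborFinset a := by simpa using (hchild a).1
    rw [Matrix.row, hentry, Finset.sum_eq_single_of_mem (child a : V) hmem, compPart,
      Set.indicator_of_mem (mem_compVerts.mpr ⟨(child a).2, rfl⟩)]
    · exact (child a).2
    · intro v hv hvc
      by_contra hne
      rcases hd.eq_or_lt_of_adj_compVerts a.2.1 (hchild a)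
        (mem_compVerts_of_compPart_ne_zero hne) ((G.mem_neighborFinset a v).mp hv) with h | h
      · exact hvc h.2
      · exact h.false
  · rw [Matrix.row, hentry] at hne
    obtain ⟨v, hv, hne⟩ := Finset.exists_ne_zero_of_sum_ne_zero hne
    exact ⟨v, mem_compVerts_of_compPart_ne_zero hne, (G.mem_neighborFinset a v).mp hv⟩

lemma exists_sum_smul_compPart_eq [Fintype (Comp G (zeroSet x))] (hG : G.IsAcyclic)
    (hx : x ∈ (adjEnd G).eigenspace lam) (hy : y ∈ (adjEnd G).eigenspace lam)
    (hxy : zeroSet x ⊆ zeroSet y) :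
    ∃ α : Comp G (zeroSet x) → ℝ, ∑ C, α C • compPart G x C = y := by
  let ratio : ((zeroSet x)ᶜ : Set V) → ℝ := fun v => y v / x v
  have hconst : ∀ v w (p : (G.induce (zeroSet x)ᶜ).Walk v w), p.IsPath → ratio v = ratio w := by
    rintro v w p -
    induction p with
    | nil => rfl
    | @cons u v w huv _ ih =>
      refine Eq.trans ?_ ih
      simp only [ratio]
      rw [div_eq_div_iff u.2 v.2, mul_comm (y u), mul_comm (y v)]
      exact (eigenvector_mul_eq_of_adj hG hx hy huv).symm
  refine ⟨fun C => C.lift ratio hconst, funext fun v => ?_⟩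
  by_cases hv : v ∈ zeroSet x
  · exact (sum_smul_compPart_apply_of_mem _ hv).trans (hxy hv).symm
  · rw [sum_smul_compPart_apply_of_notMem _ hv]
    exact div_mul_cancel₀ (y v) hv

lemma sum_smul_compPart_mem_eigenspace_iff [Fintype (Comp G (zeroSet x))]
    (hx : x ∈ (adjEnd G).eigenspace lam) (α : Comp G (zeroSet x) → ℝ) :
    ∑ C, α C • compPart G x C ∈ (adjEnd G).eigenspace lam ↔ (boundaryMatrix G x).mulVec α = 0 := by
  have hmul : ∀ a : boundary G (zeroSet x),
      (boundaryMatrix G x).mulVec α a = adjEnd G (∑ C, α C • compPart G x C) a := by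
    intro a
    simp [Matrix.mulVec, dotProduct, boundaryMatrix, mul_comm]
  rw [mem_eigenspace_iff, funext_iff]
  refine ⟨fun h a => ?_, fun h v => ?_⟩
  · rw [hmul, h, sum_smul_compPart_apply_of_mem α a.2.1, mul_zero, Pi.zero_apply]
  · by_cases hv : v ∈ boundary G (zeroSet x)
    · rw [sum_smul_compPart_apply_of_mem α hv.1, mul_zero]
      exact (hmul ⟨v, hv⟩).symm.trans (h ⟨v, hv⟩)
    · simp only [map_sum, map_smul, Finset.sum_apply, Pi.smul_apply, smul_eq_mul, Finset.mul_sum,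
        adjEnd_compPart_of_notMem_boundary hx _ hv, mul_left_comm]

lemma eigenspace_eq_map_ker_boundaryMatrix [Fintype (Comp G (zeroSet x))] (hG : G.IsAcyclic)
    (hx : x ∈ (adjEnd G).eigenspace lam) (hx0 : zeroSet x = eigZeroSet G lam) :
    (adjEnd G).eigenspace lam =
      (LinearMap.ker (boundaryMatrix G x).mulVecLin).map
        (Fintype.linearCombination ℝ (compPart G x)) := by
  ext y
  simp only [Submodule.mem_map, LinearMap.mem_ker, Matrix.mulVecLin_apply,
    Fintype.linearCombination_apply, ← sum_smul_compPart_mem_eigenspace_iff hx]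
  constructor
  · intro hy
    obtain ⟨α, rfl⟩ := exists_sum_smul_compPart_eq hG hx hy
      fun v hv => mem_eigZeroSet.mp (hx0 ▸ hv) y hy
    exact ⟨α, hy, rfl⟩
  · rintro ⟨α, hα, rfl⟩
    exact hα

lemma multiplicity_add_card_boundary (hG : G.IsAcyclic) (lam : ℝ) :
    multiplicity G lam + Nat.card (boundary G (eigZeroSet G lam)) =
      Nat.card (Comp G (eigZeroSet G lam)) := by
  obtain ⟨x, hx, hx0⟩ := exists_zeroSet_eq_eigZeroSet G lam
  have := Fintype.ofFinite (Comp G (zeroSet x))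
  have := Fintype.ofFinite (boundary G (zeroSet x))
  have hrank : (boundaryMatrix G x).rank = Fintype.card (boundary G (zeroSet x)) :=
    (linearIndependent_boundaryMatrix hG hx).rank_matrix
  have hker : multiplicity G lam =
      Module.finrank ℝ (LinearMap.ker (boundaryMatrix G x).mulVecLin) := by
    rw [multiplicity, eigenspace_eq_map_ker_boundaryMatrix hG hx hx0]
    exact (Submodule.equivMapOfInjective _
      linearIndependent_compPart.fintypeLinearCombination_injective _).symm.finrank_eq
  have hsum := (boundaryMatrix G x).mulVecLin.finrank_range_add_finrank_ker
  rw [← Matrix.rank, hrank, ← hker, Module.finrank_fintype_fun_eq_card] at hsum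
  rw [← hx0, Nat.card_eq_fintype_card, Nat.card_eq_fintype_card, add_comm, hsum]

end Eigenspace

section Skeleton

variable {V : Type*} [Fintype V] {G : SimpleGraph V} {lam : ℝ}

lemma mem_eigAdjZeroSet_iff_mem_boundary {v : V} (hv : v ∈ eigZeroSet G lam) :
    v ∈ eigAdjZeroSet G lam ↔ v ∈ boundary G (eigZeroSet G lam) := by
  constructor
  · rintro ⟨x, hx, -, C, w, hw, hvw⟩
    exact ⟨hv, w, fun hwN => (mem_compVerts.mp hw).1 (hwN x hx), hvw⟩
  · rintro ⟨-, w, hw, hvw⟩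
    obtain ⟨x, hx, hxw⟩ : ∃ x, IsEigenvector G lam x ∧ w ∉ zeroSet x := by
      simpa [eigZeroSet] using hw
    exact ⟨x, hx, hv x hx, _, w, mem_compVerts.mpr ⟨hxw, rfl⟩, hvw⟩

/-- The vertex `c_i` of the skeleton into which a component is contracted. -/
def compVertex (C : Comp G (eigZeroSet G lam)) : SkeletonVertex G lam :=
  ⟨Sum.inl C, Or.inl ⟨C, rfl⟩⟩

/-- The vertex of the skeleton given by a boundary vertex, which the contraction keeps. -/
def boundaryVertex (a : boundary G (eigZeroSet G lam)) : SkeletonVertex G lam :=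
  ⟨Sum.inr ⟨a, forall_notMem_compVerts_iff.mpr a.2.1⟩,
    Or.inr ⟨_, rfl, (mem_eigAdjZeroSet_iff_mem_boundary a.2.1).mpr a.2⟩⟩

lemma compVertex_injective : (compVertex (G := G) (lam := lam)).Injective :=
  fun _ _ h => Sum.inl_injective (congrArg Subtype.val h)

lemma boundaryVertex_injective : (boundaryVertex (G := G) (lam := lam)).Injective :=
  fun a b h => by
    have hval : (boundaryVertex a).1 = (boundaryVertex b).1 := congrArg Subtype.val h
    exact Subtype.ext (congrArg (fun v => v.1) (Sum.inr_injective hval))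

lemma range_compVertex : Set.range compVertex = contractedVertices G lam :=
  Set.ext fun _ => exists_congr fun _ => Subtype.ext_iff.trans eq_comm

lemma range_boundaryVertex : Set.range boundaryVertex = (contractedVertices G lam)ᶜ := by
  refine Set.Subset.antisymm ?_ ?_
  · rintro _ ⟨a, rfl⟩ ⟨C, hC⟩
    exact Sum.inr_ne_inl hC
  · rintro ⟨_, ⟨C, rfl⟩ | ⟨v, rfl, hv⟩⟩ hs
    · exact absurd ⟨C, rfl⟩ hs
    · have hvN := forall_notMem_compVerts_iff.mp v.2
      exact ⟨⟨v, (mem_eigAdjZeroSet_iff_mem_boundary hvN).mp hv⟩, rfl⟩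

lemma ncard_contractedVertices :
    (contractedVertices G lam).ncard = Nat.card (Comp G (eigZeroSet G lam)) := by
  rw [← range_compVertex, Set.ncard_range_of_injective compVertex_injective]

lemma ncard_compl_contractedVertices :
    (contractedVertices G lam)ᶜ.ncard = Nat.card (boundary G (eigZeroSet G lam)) := by
  rw [← range_boundaryVertex, Set.ncard_range_of_injective boundaryVertex_injective]

lemma skeleton_adj_boundaryVertex_compVertex {a : boundary G (eigZeroSet G lam)}
    {C : Comp G (eigZeroSet G lam)} :
    (skeleton G lam).Adj (boundaryVertex a) (compVertex C) ↔
      ∃ v ∈ compVerts G (eigZeroSet G lam) C, G.Adj a v := by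
  constructor
  · rintro ⟨-, _, rfl, v, hv, hav⟩
    exact ⟨v, hv, hav⟩
  · rintro ⟨v, hv, hav⟩
    exact ⟨Sum.inr_ne_inl, a, rfl, v, hv, hav⟩

lemma isIndepSet_contractedVertices : (skeleton G lam).IsIndepSet (contractedVertices G lam) := by
  rw [← range_compVertex]
  rintro _ ⟨C, rfl⟩ _ ⟨C', rfl⟩ - ⟨hne, u, hu, v, hv, huv⟩
  obtain ⟨huN, rfl⟩ := mem_compVerts.mp hu
  obtain ⟨hvN, rfl⟩ := mem_compVerts.mp hv
  obtain ⟨_, hC⟩ := mem_compVerts.mp ((mem_compVerts_iff_of_adj huv huN hvN).mp hu)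
  exact hne (congrArg Sum.inl hC.symm)

lemma IsDepthFunction.exists_isMatching_skeleton {d : V → ℕ} (hd : IsDepthFunction G d) :
    ∃ M : (skeleton G lam).Subgraph, M.IsMatching ∧
      M.edgeSet.ncard = (contractedVertices G lam)ᶜ.ncard ∧
      ∀ r : ((eigZeroSet G lam)ᶜ : Set V), d r = 0 →
        compVertex ((G.induce (eigZeroSet G lam)ᶜ).connectedComponentMk r) ∉ M.verts := by
  choose child hchild using fun a : boundary G (eigZeroSet G lam) =>
    hd.exists_child_notMem_eigZeroSet a.2
  have hdisj : ∀ a C, boundaryVertex (G := G) (lam := lam) a ≠ compVertex C := fun a C h =>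
    Sum.inr_ne_inl (congrArg Subtype.val h)
  obtain ⟨M, hM, hverts, hcard⟩ := exists_isMatching_of_injective (H := skeleton G lam)
    boundaryVertex_injective
    (compVertex_injective.comp (hd.injective_connectedComponentMk_child hchild))
    (Set.disjoint_left.mpr (by rintro _ ⟨a, rfl⟩ ⟨a', h⟩; exact hdisj _ _ h.symm))
    fun a => skeleton_adj_boundaryVertex_compVertex.mpr
      ⟨child a, mem_compVerts.mpr ⟨(child a).2, rfl⟩, (hchild a).1⟩
  refine ⟨M, hM, hcard.trans ncard_compl_contractedVertices.symm, fun r hr => ?_⟩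
  rw [hverts]
  rintro (⟨a, h⟩ | ⟨a, h⟩)
  · exact hdisj _ _ h
  · exact hd.connectedComponentMk_child_ne a.2.1 (hchild a) hr (compVertex_injective h)

lemma exists_isMatching_ncard_edgeSet_eq (hG : G.IsAcyclic) (lam : ℝ) :
    ∃ M : (skeleton G lam).Subgraph,
      M.IsMatching ∧ M.edgeSet.ncard = (contractedVertices G lam)ᶜ.ncard := by
  obtain ⟨d, hd⟩ := exists_isDepthFunction hG
  obtain ⟨M, hM, hcard, -⟩ := hd.exists_isMatching_skeleton (lam := lam)
  exact ⟨M, hM, hcard⟩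

lemma exists_isMatching_ncard_edgeSet_eq_notMem_verts (hG : G.IsAcyclic)
    {c : SkeletonVertex G lam} (hc : c ∈ contractedVertices G lam) :
    ∃ M : (skeleton G lam).Subgraph,
      M.IsMatching ∧ M.edgeSet.ncard = (contractedVertices G lam)ᶜ.ncard ∧ c ∉ M.verts := by
  rw [← range_compVertex] at hc
  obtain ⟨C, rfl⟩ := hc
  induction C using SimpleGraph.ConnectedComponent.ind with
  | _ r =>
    obtain ⟨d, hd, hr⟩ := exists_isDepthFunction_apply_eq_zero hG (r : V)
    obtain ⟨M, hM, hcard, havoid⟩ := hd.exists_isMatching_skeleton (lam := lam)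
    exact ⟨M, hM, hcard, havoid r hr⟩

lemma nullSpace_apply_boundaryVertex (hG : G.IsAcyclic) {y : SkeletonVertex G lam → ℝ}
    (hy : y ∈ nullSpace (skeleton G lam)) (a : boundary G (eigZeroSet G lam)) :
    y (boundaryVertex a) = 0 := by
  classical
  have := Fintype.ofFinite (boundary G (eigZeroSet G lam))
  obtain ⟨d, hd⟩ := exists_isDepthFunction hG
  choose child hchild using fun a : boundary G (eigZeroSet G lam) =>
    hd.exists_child_notMem_eigZeroSet a.2
  let B : boundary G (eigZeroSet G lam) → Comp G (eigZeroSet G lam) → ℝ := fun a C =>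
    if (skeleton G lam).Adj (boundaryVertex a) (compVertex C) then 1 else 0
  have hB : LinearIndependent ℝ B := by
    refine hd.linearIndependent_of_incidence hchild (fun a => ?_) fun a C hne => ?_
    · refine ne_of_eq_of_ne (if_pos ?_) one_ne_zero
      exact skeleton_adj_boundaryVertex_compVertex.mpr
        ⟨child a, mem_compVerts.mpr ⟨(child a).2, rfl⟩, (hchild a).1⟩
    · refine skeleton_adj_boundaryVertex_compVertex.mp ?_
      by_contra hnadj
      exact hne (if_neg hnadj)
  refine Fintype.linearIndependent_iff.mp hB (fun a => y (boundaryVertex a)) (funext fun C => ?_) a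
  have hC : ∑ s, (if (skeleton G lam).Adj (compVertex C) s then y s else 0) = 0 := by
    rw [← Finset.sum_filter, ← SimpleGraph.neighborFinset_eq_filter, ← adjEnd_apply]
    exact congrFun (LinearMap.mem_ker.mp hy) _
  rw [Finset.sum_apply, Pi.zero_apply, ← hC]
  refine Fintype.sum_of_injective boundaryVertex boundaryVertex_injective _ _ (fun s hs => ?_)
    fun a => by simp [B, SimpleGraph.adj_comm]
  rw [range_boundaryVertex, Set.notMem_compl_iff] at hs
  exact if_neg fun hadj => isIndepSet_contractedVertices ⟨C, rfl⟩ hs hadj.ne hadj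

end Skeleton

end TreeSkeleton

open TreeSkeleton in
theorem mainTheorem1_general {V : Type*} [Fintype V] (G : SimpleGraph V) (hG : G.IsAcyclic)
    (lam : ℝ) :
    {s : SkeletonVertex G lam |
        ∃ M : (skeleton G lam).Subgraph, IsMaximumMatching M ∧ s ∉ M.verts} =
      contractedVertices G lam ∧
    (∀ M : (skeleton G lam).Subgraph, IsMaximumMatching M →
      {s : SkeletonVertex G lam | s ∉ M.verts}.ncard = multiplicity G lam) ∧
    (∀ y ∈ nullSpace (skeleton G lam), ∀ s : SkeletonVertex G lam, y s ≠ 0 →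
      s ∈ contractedVertices G lam) := by
  have hindep := isIndepSet_contractedVertices (G := G) (lam := lam)
  have hsat := exists_isMatching_ncard_edgeSet_eq hG lam
  refine ⟨?missed, fun M hM => ?count, fun y hy s hs => ?null⟩
  case missed =>
    exact setOf_missed_by_isMaximumMatching_eq hindep hsat
      fun _ => exists_isMatching_ncard_edgeSet_eq_notMem_verts hG
  case count =>
    obtain ⟨hmatch, hcard⟩ := (isMaximumMatching_iff_ncard_edgeSet_eq hindep hsat).mp hM
    have hmissed := ncard_missed_add_ncard_compl hmatch hcard
    rw [ncard_contractedVertices, ncard_compl_contractedVertices,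
      ← multiplicity_add_card_boundary hG] at hmissed
    exact Nat.add_right_cancel hmissed
  case null =>
    by_contra hsK
    obtain ⟨a, rfl⟩ := range_boundaryVertex.superset hsK
    exact hs (nullSpace_apply_boundaryVertex hG hy a)

theorem mainTheorem1 {V : Type*} [Fintype V] (T : SimpleGraph V) (hT : T.IsTree)
    (lam : ℝ) (hlam : TreeSkeleton.IsEigenvalue T lam) :
    {s : TreeSkeleton.SkeletonVertex T lam |
        ∃ M : (TreeSkeleton.skeleton T lam).Subgraph,
          TreeSkeleton.IsMaximumMatching M ∧ s ∉ M.verts} =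
      TreeSkeleton.contractedVertices T lam ∧
    (∀ M : (TreeSkeleton.skeleton T lam).Subgraph, TreeSkeleton.IsMaximumMatching M →
      {s : TreeSkeleton.SkeletonVertex T lam | s ∉ M.verts}.ncard =
        TreeSkeleton.multiplicity T lam) ∧
    (∀ y ∈ TreeSkeleton.nullSpace (TreeSkeleton.skeleton T lam),
      ∀ s : TreeSkeleton.SkeletonVertex T lam, y s ≠ 0 →
        s ∈ TreeSkeleton.contractedVertices T lam) :=
  mainTheorem1_general T hT.isAcyclic lam
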